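/- Let $(X,d)$ be a nonempty complete CAT(0) space, let $f:X\to X$ be nonexpansive, i.e. $d(f(x),f(y))\le d(x,y)$ for all $x,y\in X$, and let $d_f:=\inf_{x\in X}d(x,f(x))$ be its minimal displacement. 1. If all orbits $\{f^n(x):n\ge 0\}$, $x\in X$, are bounded, then $f$ has a fixed point. 2. If $d_f>0$, then for every $x\in X$ there is a unique unit speed geodesic ray $\gamma:[0,\infty)\to X$ with $\gamma(0)=x$ such that $$\frac1n\, d\bigl(f^n(x),\gamma(d_f n)\bigr)\longrightarrow 0\qquad(n\to\infty).$$ Moreover, the Busemann function $b(y)=\lim_{t\to\infty}\bigl(d(y,\gamma(t))-t\bigr)$ of this ray satisfies $b(f(y))\le b(y)-d_f$ for all $y\in X$, and for every $y\in X$ the sequence $f^n(y)$ converges to the class of $\gamma$ in the visual bordification of $X$, that is, the union of $X$ and the set of asymptoty classes of geodesic rays in $X$ (two rays being asymptotic if they stay at bounded distance), with the cone topology. 3. If $d_f=0$, then for every base point $x_0\in X$ there is a metric functional $h$, that is, an element $h$ of the closure, in $\mathbb{R}^X$ with the topology of pointwise convergence, of the set of functions $y\mapsto d(y,z)-d(x_0,z)$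 with $z\in X$, such that $h(f(x))\le h(x)$ for all $x\in X$. -/

import Mathlib

open Set Filter Topology
open scoped NNReal

/-- `c`, restricted to `[0, dist x y]`, is a (unit speed) geodesic from `x` to `y`. -/
structure IsGeodesic {X : Type*} [MetricSpace X] (c : ℝ → X) (x y : X) : Prop where
  left : c 0 = x
  right : c (dist x y) = y
  isometric : ∀ s ∈ Icc 0 (dist x y), ∀ t ∈ Icc 0 (dist x y), dist (c s) (c t) = |s - t|

/-- A CAT(0) space: a geodesic metric space all of whose geodesic triangles are at least as thin
as their comparison triangles in the Euclidean plane. By the symmetry of the roles of the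
vertices, it suffices to compare a point `p` of a side `[x, y]` with a point `q` of
a side `[x, z]`. -/
class CAT0Space (X : Type*) [MetricSpace X] : Prop where
  exists_geodesic : ∀ x y : X, ∃ c : ℝ → X, IsGeodesic c x y
  dist_le_comparison : ∀ (x y z : X) (c₁ c₂ : ℝ → X), IsGeodesic c₁ x y → IsGeodesic c₂ x z →
    ∀ p ∈ c₁ '' Icc 0 (dist x y), ∀ q ∈ c₂ '' Icc 0 (dist x z),
    ∀ x' y' z' : EuclideanSpace ℝ (Fin 2),
      dist x' y' = dist x y → dist x' z' = dist x z → dist y' z' = dist y z →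
    ∀ p' ∈ segment ℝ x' y', ∀ q' ∈ segment ℝ x' z',
      dist x' p' = dist x p → dist x' q' = dist x q → dist p q ≤ dist p' q'

/-- A (unit speed) geodesic ray `[0, ∞) → X`. -/
@[ext]
structure GeodesicRay (X : Type*) [MetricSpace X] where
  toFun : ℝ≥0 → X
  isometry : Isometry toFun

instance {X : Type*} [MetricSpace X] : CoeFun (GeodesicRay X) (fun _ => ℝ≥0 → X) :=
  ⟨GeodesicRay.toFun⟩

namespace GeodesicRay

/-- The Busemann function of a geodesic ray, `b(y) = lim_{t → ∞} (d(y, γ(t)) - t)`. -/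
noncomputable def busemann {X : Type*} [MetricSpace X] (γ : GeodesicRay X) (y : X) : ℝ :=
  limUnder atTop (fun t : ℝ≥0 => dist y (γ t) - (t : ℝ))

/-- The limit defining the Busemann function exists. -/
theorem tendsto_busemann {X : Type*} [MetricSpace X] (γ : GeodesicRay X) (y : X) :
    Tendsto (fun t : ℝ≥0 => dist y (γ t) - (t : ℝ)) atTop (𝓝 (γ.busemann y)) := by
  have hanti : Antitone (fun t : ℝ≥0 => dist y (γ t) - (t : ℝ)) := by
    intro s t hst
    have h1 := dist_triangle y (γ s) (γ t)
    have h2 : dist (γ s) (γ t) = (t : ℝ) - s := by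
      rw [γ.isometry.dist_eq, NNReal.dist_eq, abs_sub_comm, abs_of_nonneg]
      exact sub_nonneg.2 (NNReal.coe_le_coe.2 hst)
    simp only
    linarith
  have hbdd : BddBelow (range (fun t : ℝ≥0 => dist y (γ t) - (t : ℝ))) := by
    refine ⟨-dist y (γ 0), ?_⟩
    rintro _ ⟨t, rfl⟩
    have h1 := dist_triangle_left (γ 0) (γ t) y
    have h2 : dist (γ 0) (γ t) = (t : ℝ) := by
      rw [γ.isometry.dist_eq, NNReal.dist_eq]
      simp
    simp only
    linarith
  exact tendsto_nhds_limUnder ⟨_, tendsto_atTop_ciInf hanti hbdd⟩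

/-- Two geodesic rays are asymptotic if they stay at bounded distance from each other. -/
instance asymptoticSetoid (X : Type*) [MetricSpace X] : Setoid (GeodesicRay X) where
  r γ₁ γ₂ := ∃ K : ℝ, ∀ t : ℝ≥0, dist (γ₁ t) (γ₂ t) ≤ K
  iseqv :=
    { refl := fun γ => ⟨0, fun t => by simp⟩
      symm := fun ⟨K, hK⟩ => ⟨K, fun t => by rw [dist_comm]; exact hK t⟩
      trans := fun ⟨K, hK⟩ ⟨L, hL⟩ =>
        ⟨K + L, fun t => (dist_triangle _ _ _).trans (add_le_add (hK t) (hL t))⟩ }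

end GeodesicRay

/-- The visual boundary: asymptoty classes of geodesic rays. -/
def VisualBoundary (X : Type*) [MetricSpace X] : Type _ :=
  Quotient (GeodesicRay.asymptoticSetoid X)

/-- The point at infinity defined by a geodesic ray. -/
def GeodesicRay.endpoint {X : Type*} [MetricSpace X] (γ : GeodesicRay X) : VisualBoundary X :=
  Quotient.mk (GeodesicRay.asymptoticSetoid X) γ

/-- The visual bordification: the disjoint union of `X` and its visual boundary. -/
inductive VisualBordification (X : Type*) [MetricSpace X] where
  | inner : X → VisualBordification X
  | ideal : VisualBoundary X → VisualBordification X

namespace VisualBordification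

/-- The basic cone neighbourhood `U(c, r, ε)`: the points of `X` and of the boundary that are at
distance more than `r` from `c 0` and whose geodesic segment or ray issuing from `c 0` passes, at
time `r`, at distance less than `ε` from `c r`. -/
def coneNhd {X : Type*} [MetricSpace X] (c : GeodesicRay X) (r : ℝ≥0) (ε : ℝ) :
    Set (VisualBordification X) :=
  {u | match u with
    | inner x => (r : ℝ) < dist (c 0) x ∧
        ∃ σ : ℝ → X, IsGeodesic σ (c 0) x ∧ dist (σ r) (c r) < ε
    | ideal ξ => ∃ γ : GeodesicRay X, γ 0 = c 0 ∧ γ.endpoint = ξ ∧ dist (γ r) (c r) < ε}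

/-- The cone topology, generated by the open balls of `X` and the sets `U(c, r, ε)`. -/
instance coneTopology (X : Type*) [MetricSpace X] : TopologicalSpace (VisualBordification X) :=
  TopologicalSpace.generateFrom
    ({U | ∃ (x : X) (r : ℝ), U = inner '' Metric.ball x r} ∪
      {U | ∃ (c : GeodesicRay X) (r : ℝ≥0) (ε : ℝ), 0 < r ∧ 0 < ε ∧ U = coneNhd c r ε})

end VisualBordification

/-- The minimal displacement `d_f = inf_x d(x, f(x))`. -/
noncomputable def minimalDisplacement {X : Type*} [MetricSpace X] (f : X → X) : ℝ≥0 :=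
  ⨅ x : X, nndist x (f x)

/-- Metric functionals with base point `x₀`: the elements of the closure, for pointwise
convergence, of the set of functions `h_z = d(·, z) - d(x₀, z)`, `z ∈ X`. -/
def IsMetricFunctional {X : Type*} [MetricSpace X] (x₀ : X) (h : X → ℝ) : Prop :=
  h ∈ closure (range (fun (z : X) (y : X) => dist y z - dist x₀ z))

/-!
The argument rests on the resolvents of `f`. For `t < 1` the map sending `u` to the point of
`[x, f u]` at fraction `t` is a contraction, so it has a fixed point `y_t`. Convexity of the distance
to `f u` along `[x, f (y_t)]`, nonexpansiveness, and `dist (y_t) (f (y_t)) ≥ d_f` together show that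
the functions `u ↦ dist u (y_t)` decrease under `f` by at least `d_f`, up to an error that vanishes
as `t → 1` (`exists_seq_eventually_dist_le`). A pointwise cluster point of the normalized functions
is the metric functional sought when `d_f = 0` (`exists_isMetricFunctional_le`).

When `d_f > 0`, iterating this decay shows that `dist x (f^[n] x) / n → d_f` and that, for `y_t` far
away, the triangle `x, f^[n] x, y_t` is nearly degenerate. The Bruhat–Tits inequality then puts
`f^[n] x` at sublinear distance from the point of `[x, y_t]` at time `n d_f`, uniformly in `t`
(`exists_sublinear_dist_iterate_le`). Since geodesics from `x` diverge at least linearly,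
`[x, y_t]` converges to a ray tracking the orbit (`exists_ray_tendsto`), and the same divergence
gives uniqueness. The functions `dist · (y_t) - dist x (y_t)` converge to the Busemann function of
the ray, which therefore inherits the decay under `f` (`GeodesicRay.busemann_le_of_tendsto`). For
convergence in the cone topology, a neighbourhood based at another point is treated through the
tracking ray from that point, which is asymptotic to the given one (`tendsto_inner_iterate`).

When orbits are bounded, the asymptotic centre of an orbit exists by the Bruhat–Tits inequality, and
its uniqueness makes it a fixed point (`exists_fixedPoint_of_isBounded_orbit`).
-/

/-! ### Comparison triangles and the convexity of the metric -/

theorem EuclideanSpace.exists_triangle {a b c : ℝ} (ha : 0 ≤ a) (hb : 0 ≤ b) (hc : 0 ≤ c)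
    (habc : a ≤ b + c) (hbac : b ≤ a + c) (hcab : c ≤ a + b) :
    ∃ x y z : EuclideanSpace ℝ (Fin 2), dist x y = a ∧ dist x z = b ∧ dist y z = c := by
  -- For `a = 0` the junk value `u = 0` still satisfies the law of cosines, because then `b = c`.
  obtain ⟨u, hu⟩ : ∃ u : ℝ, 2 * a * u = a ^ 2 + b ^ 2 - c ^ 2 ∧ u ^ 2 ≤ b ^ 2 := by
    rcases ha.eq_or_lt with rfl | ha
    · obtain rfl : b = c := by linarith
      exact ⟨0, by ring, by simpa using sq_nonneg b⟩
    · refine ⟨(a ^ 2 + b ^ 2 - c ^ 2) / (2 * a), by field_simp, ?_⟩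
      rw [div_pow, div_le_iff₀ (by positivity)]
      have h1 : 0 ≤ (b + c - a) * (a + c - b) := mul_nonneg (by linarith) (by linarith)
      have h2 : 0 ≤ (a + b - c) * (a + b + c) := mul_nonneg (by linarith) (by linarith)
      nlinarith [mul_nonneg h1 h2]
  refine ⟨!₂[0, 0], !₂[a, 0], !₂[u, √(b ^ 2 - u ^ 2)], ?_, ?_, ?_⟩
  · simp [EuclideanSpace.dist_eq, Real.dist_eq, Real.sqrt_sq ha]
  · simp [EuclideanSpace.dist_eq, Real.dist_eq, Real.sq_sqrt (sub_nonneg.2 hu.2),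
      Real.sqrt_sq hb]
  · simp only [EuclideanSpace.dist_eq, Real.dist_eq, Fin.sum_univ_two, sq_abs]
    simp [Real.sq_sqrt (sub_nonneg.2 hu.2)]
    rw [show (a - u) ^ 2 + (b ^ 2 - u ^ 2) = c ^ 2 by linarith [hu.1], Real.sqrt_sq hc]

/-- Stewart's theorem. -/
theorem dist_lineMap_sq {E : Type*} [NormedAddCommGroup E] [InnerProductSpace ℝ E]
    (x y z : E) (t : ℝ) :
    dist (AffineMap.lineMap x y t) z ^ 2 =
      (1 - t) * dist x z ^ 2 + t * dist y z ^ 2 - t * (1 - t) * dist x y ^ 2 := by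
  have h1 : AffineMap.lineMap x y t - z = (1 - t) • (x - z) + t • (y - z) := by
    rw [AffineMap.lineMap_apply_module]; module
  have h2 : x - y = (x - z) - (y - z) := by abel
  simp only [dist_eq_norm, h1, h2]
  generalize x - z = u
  generalize y - z = v
  rw [norm_add_sq_real, norm_sub_sq_real, norm_smul, norm_smul, real_inner_smul_left,
    real_inner_smul_right, mul_pow, mul_pow, Real.norm_eq_abs, Real.norm_eq_abs, sq_abs, sq_abs]
  ring

section CAT0

variable {X : Type*} [MetricSpace X]

/-- The initial piece of a curve parametrized by arc length is a geodesic. -/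
theorem isGeodesic_of_dist_eq {c : ℝ → X} {L m : ℝ}
    (hc : ∀ s ∈ Icc 0 L, ∀ t ∈ Icc 0 L, dist (c s) (c t) = |s - t|) (hm : m ∈ Icc 0 L) :
    dist (c 0) (c m) = m ∧ IsGeodesic c (c 0) (c m) := by
  have h : dist (c 0) (c m) = m := by
    rw [hc 0 ⟨le_rfl, hm.1.trans hm.2⟩ m hm, zero_sub, abs_neg, abs_of_nonneg hm.1]
  refine ⟨h, rfl, by rw [h], fun s hs t ht => ?_⟩
  rw [h] at hs ht
  exact hc s ⟨hs.1, hs.2.trans hm.2⟩ t ⟨ht.1, ht.2.trans hm.2⟩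

theorem IsGeodesic.dist_left {c : ℝ → X} {x y : X} (hc : IsGeodesic c x y) {s : ℝ}
    (hs : s ∈ Icc 0 (dist x y)) : dist x (c s) = s := by
  simpa only [hc.left] using (isGeodesic_of_dist_eq hc.isometric hs).1

theorem IsGeodesic.dist_right {c : ℝ → X} {x y : X} (hc : IsGeodesic c x y) {s : ℝ}
    (hs : s ∈ Icc 0 (dist x y)) : dist (c s) y = dist x y - s := by
  have h := hc.isometric s hs _ ⟨dist_nonneg, le_rfl⟩
  rw [hc.right, abs_sub_comm, abs_of_nonneg (sub_nonneg.2 hs.2)] at h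
  exact h

variable [CAT0Space X]

/-- The CAT(0) inequality in terms of the fractions at which the two points divide their sides. -/
theorem IsGeodesic.exists_comparison {x y z : X} {c₁ c₂ : ℝ → X} (h₁ : IsGeodesic c₁ x y)
    (h₂ : IsGeodesic c₂ x z) {s t : ℝ} (hs : s ∈ Icc (0 : ℝ) 1) (ht : t ∈ Icc (0 : ℝ) 1) :
    ∃ x' y' z' : EuclideanSpace ℝ (Fin 2),
      dist x' y' = dist x y ∧ dist x' z' = dist x z ∧ dist y' z' = dist y z ∧
      dist (c₁ (s * dist x y)) (c₂ (t * dist x z)) ≤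
        dist (AffineMap.lineMap x' y' s) (AffineMap.lineMap x' z' t) := by
  obtain ⟨x', y', z', hxy, hxz, hyz⟩ := EuclideanSpace.exists_triangle
    (dist_nonneg (x := x) (y := y)) (dist_nonneg (x := x) (y := z))
    (dist_nonneg (x := y) (y := z)) (by rw [dist_comm y z]; exact dist_triangle x z y)
    (dist_triangle x y z) (by rw [dist_comm x y]; exact dist_triangle y x z)
  have key : ∀ {r D : ℝ}, r ∈ Icc (0 : ℝ) 1 → 0 ≤ D → r * D ∈ Icc 0 D := fun hr hD =>
    ⟨mul_nonneg hr.1 hD, mul_le_of_le_one_left hD hr.2⟩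
  have hs' := key hs (dist_nonneg (x := x) (y := y))
  have ht' := key ht (dist_nonneg (x := x) (y := z))
  refine ⟨x', y', z', hxy, hxz, hyz, CAT0Space.dist_le_comparison x y z c₁ c₂ h₁ h₂ _
    (mem_image_of_mem _ hs') _ (mem_image_of_mem _ ht') x' y' z' hxy hxz hyz _ ?_ _ ?_ ?_ ?_⟩
  · rw [segment_eq_image_lineMap]; exact mem_image_of_mem _ hs
  · rw [segment_eq_image_lineMap]; exact mem_image_of_mem _ ht
  · rw [dist_left_lineMap, h₁.dist_left hs', hxy, Real.norm_of_nonneg hs.1]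
  · rw [dist_left_lineMap, h₂.dist_left ht', hxz, Real.norm_of_nonneg ht.1]

/-- Geodesics issuing from a common point diverge at least linearly. -/
theorem IsGeodesic.dist_le_mul {x y z : X} {c₁ c₂ : ℝ → X} (h₁ : IsGeodesic c₁ x y)
    (h₂ : IsGeodesic c₂ x z) {t : ℝ} (ht : t ∈ Icc (0 : ℝ) 1) :
    dist (c₁ (t * dist x y)) (c₂ (t * dist x z)) ≤ t * dist y z := by
  obtain ⟨x', y', z', -, -, hyz, h⟩ := h₁.exists_comparison h₂ ht ht
  refine h.trans_eq ?_
  rw [← hyz, dist_eq_norm, dist_eq_norm, ← Real.norm_of_nonneg ht.1, ← norm_smul,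
    Real.norm_of_nonneg ht.1, AffineMap.lineMap_apply_module, AffineMap.lineMap_apply_module]
  congr 1
  module

/-- The Bruhat–Tits inequality: the distance to a point of a geodesic is at most the one given by
Stewart's theorem. -/
theorem IsGeodesic.dist_sq_le {x y : X} {c : ℝ → X} (h : IsGeodesic c x y) (z : X) {t : ℝ}
    (ht : t ∈ Icc (0 : ℝ) 1) :
    dist (c (t * dist x y)) z ^ 2 ≤
      (1 - t) * dist x z ^ 2 + t * dist y z ^ 2 - t * (1 - t) * dist x y ^ 2 := by
  obtain ⟨c₂, h₂⟩ := CAT0Space.exists_geodesic x z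
  obtain ⟨x', y', z', hxy, hxz, hyz, hle⟩ :=
    h.exists_comparison h₂ ht (right_mem_Icc.2 zero_le_one)
  rw [one_mul, h₂.right, AffineMap.lineMap_apply_one] at hle
  refine (pow_le_pow_left₀ dist_nonneg hle 2).trans_eq ?_
  rw [dist_lineMap_sq, hxy, hxz, hyz]

theorem IsGeodesic.dist_le_convex {x y : X} {c : ℝ → X} (h : IsGeodesic c x y) (z : X) {t : ℝ}
    (ht : t ∈ Icc (0 : ℝ) 1) :
    dist (c (t * dist x y)) z ≤ (1 - t) * dist x z + t * dist y z := by
  have h1 : 0 ≤ 1 - t := sub_nonneg.2 ht.2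
  have h0 := ht.1
  refine le_of_sq_le_sq ((h.dist_sq_le z ht).trans ?_) (by positivity)
  have h2 : (dist x z - dist y z) ^ 2 ≤ dist x y ^ 2 :=
    sq_le_sq' (by linarith [dist_triangle_left y z x]) (by linarith [dist_triangle x y z])
  nlinarith [mul_le_mul_of_nonneg_left h2 (mul_nonneg h0 h1)]

/-- Linear divergence for arc-length parametrized curves issuing from a common point. -/
theorem mul_dist_le_mul_dist {c₁ c₂ : ℝ → X} {r m : ℝ}
    (h₁ : ∀ s ∈ Icc 0 m, ∀ t ∈ Icc 0 m, dist (c₁ s) (c₁ t) = |s - t|)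
    (h₂ : ∀ s ∈ Icc 0 m, ∀ t ∈ Icc 0 m, dist (c₂ s) (c₂ t) = |s - t|)
    (h0 : c₁ 0 = c₂ 0) (hr : r ∈ Icc 0 m) :
    m * dist (c₁ r) (c₂ r) ≤ r * dist (c₁ m) (c₂ m) := by
  rcases (hr.1.trans hr.2).eq_or_lt with rfl | hm
  · simp [hr.2.antisymm hr.1]
  obtain ⟨e₁, g₁⟩ := isGeodesic_of_dist_eq h₁ ⟨hm.le, le_rfl⟩
  obtain ⟨e₂, g₂⟩ := isGeodesic_of_dist_eq h₂ ⟨hm.le, le_rfl⟩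
  rw [← h0] at e₂ g₂
  have h := g₁.dist_le_mul g₂ (t := r / m) ⟨div_nonneg hr.1 hm.le, (div_le_one hm).2 hr.2⟩
  rw [e₁, e₂, div_mul_cancel₀ _ hm.ne', div_mul_eq_mul_div, le_div_iff₀ hm] at h
  linarith

/-- In the triangle `x, z, p` the point `c m` of the side `[x, z]` is close to `p` once
`dist x p` and `dist x z - dist p z` are close to `m`. -/
theorem IsGeodesic.dist_sq_le_add {x z : X} {c : ℝ → X} (hc : IsGeodesic c x z) (p : X)
    {m : ℝ} (hm : m ∈ Icc 0 (dist x z)) (hxz : 0 < dist x z) :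
    dist (c m) p ^ 2 ≤ (m + (dist p z - dist x z)) ^ 2 +
      (1 - m / dist x z) * (dist x p ^ 2 - (dist p z - dist x z) ^ 2) := by
  have h := hc.dist_sq_le p (t := m / dist x z)
    ⟨div_nonneg hm.1 hxz.le, (div_le_one hxz).2 hm.2⟩
  rw [div_mul_cancel₀ _ hxz.ne', dist_comm z p] at h
  refine h.trans_eq ?_
  field_simp
  ring

end CAT0

/-! ### Fixed points from bounded orbits -/

section BoundedOrbits

variable {X : Type*} [MetricSpace X] [CAT0Space X]

theorem exists_midpoint_dist_sq_le (y z : X) :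
    ∃ m : X, ∀ p : X, dist m p ^ 2 ≤ (dist y p ^ 2 + dist z p ^ 2) / 2 - dist y z ^ 2 / 4 := by
  obtain ⟨c, hc⟩ := CAT0Space.exists_geodesic y z
  refine ⟨c (1 / 2 * dist y z), fun p => ?_⟩
  have h := hc.dist_sq_le p (t := 1 / 2) ⟨by norm_num, by norm_num⟩
  linarith

/-- If no closed ball of radius less than `r` contains a tail of `u`, then the centres of two balls
of radius `ρ` containing a tail of `u` are close to each other when `ρ` is close to `r`. -/
theorem dist_sq_le_of_eventually_dist_le {u : ℕ → X} {r ρ : ℝ} (hr : 0 ≤ r)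
    (hmin : ∀ (m : X) (s : ℝ), (∀ᶠ n in atTop, dist m (u n) ≤ s) → r ≤ s) {y z : X}
    (hy : ∀ᶠ n in atTop, dist y (u n) ≤ ρ) (hz : ∀ᶠ n in atTop, dist z (u n) ≤ ρ) :
    dist y z ^ 2 ≤ 4 * (ρ ^ 2 - r ^ 2) := by
  obtain ⟨m, hm⟩ := exists_midpoint_dist_sq_le y z
  have key : ∀ᶠ n in atTop, dist m (u n) ^ 2 ≤ ρ ^ 2 - dist y z ^ 2 / 4 := by
    filter_upwards [hy, hz] with n h1 h2
    have := hm (u n)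
    have := pow_le_pow_left₀ dist_nonneg h1 2
    have := pow_le_pow_left₀ dist_nonneg h2 2
    linarith
  obtain ⟨n, hn⟩ := key.exists
  have h0 : 0 ≤ ρ ^ 2 - dist y z ^ 2 / 4 := (sq_nonneg _).trans hn
  have h := hmin m _ (key.mono fun n hn => Real.le_sqrt_of_sq_le hn)
  have := pow_le_pow_left₀ hr h 2
  rw [Real.sq_sqrt h0] at this
  linarith

/-- A bounded sequence in a complete CAT(0) space has an asymptotic centre. -/
theorem exists_asymptotic_center [CompleteSpace X] {u : ℕ → X}
    (hu : Bornology.IsBounded (range u)) :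
    ∃ (r : ℝ) (c : X), 0 ≤ r ∧
      (∀ (m : X) (s : ℝ), (∀ᶠ n in atTop, dist m (u n) ≤ s) → r ≤ s) ∧
      ∀ s > r, ∀ᶠ n in atTop, dist c (u n) ≤ s := by
  set S : Set ℝ := {s | ∃ m : X, ∀ᶠ n in atTop, dist m (u n) ≤ s} with hS
  have hpos : ∀ s ∈ S, 0 ≤ s := by
    rintro s ⟨m, hm⟩
    obtain ⟨n, hn⟩ := hm.exists
    exact dist_nonneg.trans hn
  have hne : S.Nonempty := by
    obtain ⟨R, hR⟩ := Metric.isBounded_iff.1 hu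
    exact ⟨R, u 0, Eventually.of_forall fun n => hR (mem_range_self 0) (mem_range_self n)⟩
  have hr : 0 ≤ sInf S := le_csInf hne hpos
  have hmin : ∀ (m : X) (s : ℝ), (∀ᶠ n in atTop, dist m (u n) ≤ s) → sInf S ≤ s :=
    fun m s h => csInf_le ⟨0, hpos⟩ ⟨m, h⟩
  set ρ : ℕ → ℝ := fun j => sInf S + 1 / ((j : ℝ) + 1) with hρ
  have hρlim : Tendsto ρ atTop (𝓝 (sInf S)) := by
    simpa [hρ] using tendsto_one_div_add_atTop_nhds_zero_nat.const_add (sInf S)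
  have hex : ∀ j, ∃ m : X, ∀ᶠ n in atTop, dist m (u n) ≤ ρ j := fun j => by
    obtain ⟨s, ⟨m, hm⟩, hs⟩ := exists_lt_of_csInf_lt hne
      (show sInf S < ρ j from lt_add_of_pos_right _ Nat.one_div_pos_of_nat)
    exact ⟨m, hm.mono fun n hn => hn.trans hs.le⟩
  choose y hy using hex
  have hanti : Antitone ρ := fun i j hij => by
    simp only [hρ]; gcongr
  have hcauchy : CauchySeq y := by
    refine cauchySeq_of_le_tendsto_0 (fun N => √(4 * (ρ N ^ 2 - sInf S ^ 2))) ?_ ?_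
    · intro i j N hi hj
      exact Real.le_sqrt_of_sq_le (dist_sq_le_of_eventually_dist_le hr hmin
        ((hy i).mono fun n h => h.trans (hanti hi)) ((hy j).mono fun n h => h.trans (hanti hj)))
    · have := (((hρlim.pow 2).sub_const (sInf S ^ 2)).const_mul 4).sqrt
      simpa using this
  obtain ⟨c, hc⟩ := cauchySeq_tendsto_of_complete hcauchy
  refine ⟨sInf S, c, hr, hmin, fun s hs => ?_⟩
  have h1 : Tendsto (fun j => dist c (y j) + ρ j) atTop (𝓝 (sInf S)) := by
    simpa using ((tendsto_const_nhds (x := c)).dist hc).add hρlim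
  obtain ⟨j, hj⟩ := (h1.eventually_lt_const hs).exists
  filter_upwards [hy j] with n hn
  linarith [dist_triangle c (y j) (u n)]

theorem exists_fixedPoint_of_isBounded_orbit [CompleteSpace X] {f : X → X}
    (hf : ∀ x y : X, dist (f x) (f y) ≤ dist x y) {x : X}
    (hx : Bornology.IsBounded (range fun n : ℕ => f^[n] x)) : ∃ c : X, f c = c := by
  obtain ⟨r, c, hr, hmin, hc⟩ := exists_asymptotic_center hx
  have hfc : ∀ s > r, ∀ᶠ n in atTop, dist (f c) (f^[n] x) ≤ s := fun s hs => by
    rw [← map_add_atTop_eq_nat 1, eventually_map]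
    filter_upwards [hc s hs] with n hn
    rw [Function.iterate_succ_apply']
    exact (hf _ _).trans hn
  refine ⟨c, ?_⟩
  have h : ∀ s > r, dist (f c) c ^ 2 ≤ 4 * (s ^ 2 - r ^ 2) := fun s hs =>
    dist_sq_le_of_eventually_dist_le hr hmin (hfc s hs) (hc s hs)
  have hlim : Tendsto (fun s : ℝ => 4 * (s ^ 2 - r ^ 2)) (𝓝[>] r) (𝓝 0) := by
    have : Continuous fun s : ℝ => 4 * (s ^ 2 - r ^ 2) := by fun_prop
    simpa using (this.tendsto r).mono_left nhdsWithin_le_nhds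
  have h0 : dist (f c) c ^ 2 ≤ 0 := ge_of_tendsto hlim (eventually_mem_nhdsWithin.mono h)
  exact dist_eq_zero.1 (pow_eq_zero_iff two_ne_zero |>.1 (h0.antisymm (sq_nonneg _)))

end BoundedOrbits

/-! ### Approximate metric functionals -/

section Resolvent

variable {X : Type*} [MetricSpace X]

theorem minimalDisplacement_le (f : X → X) (x : X) :
    (minimalDisplacement f : ℝ) ≤ dist x (f x) := by
  rw [dist_nndist, NNReal.coe_le_coe]
  exact ciInf_le (OrderBot.bddBelow _) x

variable [CAT0Space X] [CompleteSpace X]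

/-- The resolvent: for `t < 1` there is a point `y` dividing the segment from `x` to `f y` in the
ratio `t : 1 - t`, as the map sending `u` to the point of `[x, f u]` at fraction `t` is
a contraction. -/
theorem exists_resolvent {f : X → X} (hf : ∀ x y : X, dist (f x) (f y) ≤ dist x y) (x : X)
    {t : ℝ} (ht : t ∈ Ico (0 : ℝ) 1) :
    ∃ (y : X) (c : ℝ → X), IsGeodesic c x (f y) ∧ y = c (t * dist x (f y)) := by
  choose c hc using fun u : X => CAT0Space.exists_geodesic x (f u)
  have hcontr : ContractingWith ⟨t, ht.1⟩ fun u => c u (t * dist x (f u)) := by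
    refine ⟨by exact_mod_cast ht.2, LipschitzWith.of_dist_le_mul fun u v => ?_⟩
    exact ((hc u).dist_le_mul (hc v) ⟨ht.1, ht.2.le⟩).trans
      (mul_le_mul_of_nonneg_left (hf u v) ht.1)
  have : Nonempty X := ⟨x⟩
  exact ⟨_, c _, hc _, hcontr.fixedPoint_isFixedPt.symm⟩

/-- Along the resolvents `y k`, the functions `u ↦ dist u (y k)` decrease under `f` by at least
the minimal displacement, up to an error tending to zero pointwise. -/
theorem exists_seq_eventually_dist_le {f : X → X}
    (hf : ∀ x y : X, dist (f x) (f y) ≤ dist x y) [Nonempty X] :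
    ∃ y : ℕ → X, ∀ u : X, ∀ ε > 0, ∀ᶠ k in atTop,
      dist (f u) (y k) ≤ dist u (y k) - minimalDisplacement f + ε := by
  obtain ⟨x⟩ := ‹Nonempty X›
  set t : ℕ → ℝ := fun k => 1 - 1 / ((k : ℝ) + 1) with ht
  have ht01 : ∀ k, t k ∈ Ico (0 : ℝ) 1 := fun k => by
    refine ⟨sub_nonneg.2 ((div_le_one (by positivity)).2 (by simp)), sub_lt_self _ ?_⟩
    positivity
  have htlim : Tendsto t atTop (𝓝 1) := by
    simpa [ht] using tendsto_one_div_add_atTop_nhds_zero_nat.const_sub (1 : ℝ)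
  choose y c hc hy using fun k => exists_resolvent hf x (ht01 k)
  refine ⟨y, fun u ε hε => ?_⟩
  set l : ℝ := (minimalDisplacement f : ℝ)
  have herr : Tendsto (fun k => -(t k * l) + (1 - t k) * (dist x (f u) + dist x u)) atTop
      (𝓝 (-l)) := by
    simpa using (htlim.mul_const l).neg.add
      ((htlim.const_sub 1).mul_const (dist x (f u) + dist x u))
  filter_upwards [herr.eventually_lt_const (show -l < -l + ε by linarith)] with k hk
  obtain ⟨h0, h1⟩ := ht01 k
  set D := dist x (f (y k)) with hD
  have hmem : t k * D ∈ Icc 0 D :=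
    ⟨mul_nonneg h0 dist_nonneg, mul_le_of_le_one_left dist_nonneg h1.le⟩
  have e1 : dist x (y k) = t k * D := by
    conv_lhs => rw [hy k]
    exact (hc k).dist_left hmem
  have e2 : dist (y k) (f (y k)) = D - t k * D := by
    have h := (hc k).dist_right hmem
    rwa [← hy k] at h
  have h3 : l ≤ D - t k * D := e2 ▸ minimalDisplacement_le f (y k)
  have h4 := (hc k).dist_le_convex (f u) (t := t k) ⟨h0, h1.le⟩
  rw [← hy k, dist_comm (y k), dist_comm (f (y k))] at h4
  have h5 : t k * dist (f u) (f (y k)) ≤ t k * dist u (y k) :=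
    mul_le_mul_of_nonneg_left (hf _ _) h0
  have h6 : (1 - t k) * (t k * D) ≤ (1 - t k) * (dist u (y k) + dist x u) :=
    mul_le_mul_of_nonneg_left (by rw [← e1]; linarith [dist_triangle x u (y k)]) (by linarith)
  have h7 := mul_le_mul_of_nonneg_left h3 h0
  nlinarith

/-- The functions `dist · (y k) - dist x₀ (y k)` have a pointwise cluster point, by compactness. -/
theorem exists_isMetricFunctional_le {f : X → X}
    (hf : ∀ x y : X, dist (f x) (f y) ≤ dist x y) (x₀ : X) :
    ∃ h : X → ℝ, IsMetricFunctional x₀ h ∧ ∀ x, h (f x) ≤ h x - minimalDisplacement f := by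
  have : Nonempty X := ⟨x₀⟩
  obtain ⟨y, hy⟩ := exists_seq_eventually_dist_le hf
  set H : ℕ → X → ℝ := fun k u => dist u (y k) - dist x₀ (y k) with hH
  have hcomp : IsCompact (univ.pi fun u : X => Icc (-dist u x₀) (dist u x₀)) :=
    isCompact_univ_pi fun u => isCompact_Icc
  have hmem : ∀ k, H k ∈ univ.pi fun u : X => Icc (-dist u x₀) (dist u x₀) := fun k u _ =>
    abs_le.1 (abs_dist_sub_le u x₀ (y k))
  obtain ⟨h, -, hle⟩ := hcomp.ultrafilter_le_nhds ((hyperfilter ℕ).map H)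
    (le_principal_iff.2 (Filter.mem_map.2 (Eventually.of_forall hmem)))
  have hlim : Tendsto H (hyperfilter ℕ) (𝓝 h) := hle
  have hlim' := tendsto_pi_nhds.1 hlim
  refine ⟨h, mem_closure_of_tendsto hlim (Eventually.of_forall fun k => mem_range_self (y k)),
    fun u => le_of_forall_pos_le_add fun ε hε => ?_⟩
  refine le_of_tendsto_of_tendsto (hlim' (f u))
    (((hlim' u).sub_const (minimalDisplacement f : ℝ)).add_const ε)
    ((hy u ε hε).filter_mono Nat.hyperfilter_le_atTop |>.mono fun k hk => ?_)
  simp only [hH]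
  linarith

end Resolvent

/-! ### The displacement of orbits -/

section Drift

variable {X : Type*} [MetricSpace X]

theorem dist_iterate_le {f : X → X} (hf : ∀ x y : X, dist (f x) (f y) ≤ dist x y) (n : ℕ)
    (x y : X) : dist (f^[n] x) (f^[n] y) ≤ dist x y := by
  induction n with
  | zero => rfl
  | succ n ih =>
    rw [Function.iterate_succ_apply', Function.iterate_succ_apply']
    exact (hf _ _).trans ih

theorem dist_iterate_le_mul {f : X → X} (hf : ∀ x y : X, dist (f x) (f y) ≤ dist x y) (n : ℕ)
    (x : X) : dist x (f^[n] x) ≤ n * dist x (f x) := by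
  induction n with
  | zero => simp
  | succ n ih =>
    rw [Function.iterate_succ_apply]
    have h1 := dist_triangle x (f^[n] x) (f^[n] (f x))
    have h2 := dist_iterate_le hf n x (f x)
    push_cast
    linarith

variable {f : X → X} {y : ℕ → X}

theorem eventually_dist_iterate_le
    (hy : ∀ u : X, ∀ ε > 0, ∀ᶠ k in atTop,
      dist (f u) (y k) ≤ dist u (y k) - minimalDisplacement f + ε) (x : X) (n : ℕ) {ε : ℝ}
    (hε : 0 < ε) :
    ∀ᶠ k in atTop, dist (f^[n] x) (y k) ≤ dist x (y k) - n * minimalDisplacement f + ε := by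
  induction n generalizing ε with
  | zero => exact Eventually.of_forall fun k => by simp [hε.le]
  | succ n ih =>
    filter_upwards [ih (half_pos hε), hy (f^[n] x) _ (half_pos hε)] with k h1 h2
    rw [Function.iterate_succ_apply']
    push_cast
    linarith

theorem mul_minimalDisplacement_le_dist_iterate
    (hy : ∀ u : X, ∀ ε > 0, ∀ᶠ k in atTop,
      dist (f u) (y k) ≤ dist u (y k) - minimalDisplacement f + ε) (x : X) (n : ℕ) :
    n * minimalDisplacement f ≤ dist x (f^[n] x) := by
  refine le_of_forall_pos_le_add fun ε hε => ?_
  obtain ⟨k, hk⟩ := (eventually_dist_iterate_le hy x n hε).exists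
  linarith [dist_triangle x (f^[n] x) (y k)]

/-- The escape rate of every orbit is the minimal displacement. -/
theorem tendsto_dist_iterate_div (hf : ∀ x y : X, dist (f x) (f y) ≤ dist x y)
    (hy : ∀ u : X, ∀ ε > 0, ∀ᶠ k in atTop,
      dist (f u) (y k) ≤ dist u (y k) - minimalDisplacement f + ε) (x : X) :
    Tendsto (fun n : ℕ => dist x (f^[n] x) / n) atTop (𝓝 (minimalDisplacement f)) := by
  have : Nonempty X := ⟨x⟩
  refine tendsto_order.2 ⟨fun a ha => ?_, fun a ha => ?_⟩
  · filter_upwards [eventually_gt_atTop 0] with n hn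
    refine ha.trans_le ((le_div_iff₀ (by positivity)).2 ?_)
    linarith [mul_minimalDisplacement_le_dist_iterate hy x n]
  · obtain ⟨u, hu⟩ : ∃ u, dist u (f u) < a := by
      have ha' : minimalDisplacement f < a.toNNReal := Real.lt_toNNReal_iff_coe_lt.2 ha
      obtain ⟨u, hu⟩ := exists_lt_of_ciInf_lt ha'
      exact ⟨u, by rw [dist_nndist]; exact Real.lt_toNNReal_iff_coe_lt.1 hu⟩
    have hlim : Tendsto (fun n : ℕ => dist u (f u) + 2 * dist x u / n) atTop
        (𝓝 (dist u (f u))) := by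
      simpa using (tendsto_const_div_atTop_nhds_zero_nat (2 * dist x u)).const_add (dist u (f u))
    filter_upwards [eventually_gt_atTop 0, hlim.eventually_lt_const hu] with n hn h
    refine lt_of_le_of_lt ?_ h
    have hn' : (0 : ℝ) < n := by exact_mod_cast hn
    rw [div_le_iff₀ hn', add_mul, div_mul_cancel₀ _ hn'.ne']
    have h1 := dist_iterate_le_mul hf n u
    have h2 := dist_triangle4 x u (f^[n] u) (f^[n] x)
    have h3 := dist_iterate_le hf n u x
    rw [dist_comm u x] at h3
    linarith

theorem tendsto_dist_atTop (hl : 0 < minimalDisplacement f)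
    (hy : ∀ u : X, ∀ ε > 0, ∀ᶠ k in atTop,
      dist (f u) (y k) ≤ dist u (y k) - minimalDisplacement f + ε) (x : X) :
    Tendsto (fun k => dist x (y k)) atTop atTop := by
  refine tendsto_atTop.2 fun R => ?_
  obtain ⟨n, hn⟩ := exists_nat_ge ((R + 1) / minimalDisplacement f)
  rw [div_le_iff₀ (by exact_mod_cast hl)] at hn
  filter_upwards [eventually_dist_iterate_le hy x n one_pos] with k hk
  linarith [dist_nonneg (x := f^[n] x) (y := y k)]

/-- The orbit of `x` tracks the geodesics from `x` to `y k` up to a sublinear error that does not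
depend on `k`. -/
theorem exists_sublinear_dist_iterate_le [CAT0Space X]
    (hf : ∀ x y : X, dist (f x) (f y) ≤ dist x y) (hl : 0 < minimalDisplacement f)
    (hy : ∀ u : X, ∀ ε > 0, ∀ᶠ k in atTop,
      dist (f u) (y k) ≤ dist u (y k) - minimalDisplacement f + ε) {x : X} {c : ℕ → ℝ → X}
    (hc : ∀ k, IsGeodesic (c k) x (y k)) :
    ∃ E : ℕ → ℝ, Tendsto (fun n => E n / n) atTop (𝓝 0) ∧
      ∀ᶠ n : ℕ in atTop, ∀ᶠ k in atTop,
        dist (c k (n * minimalDisplacement f)) (f^[n] x) ≤ E n := by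
  set l : ℝ := (minimalDisplacement f : ℝ) with hl_def
  have hl0 : 0 < l := hl
  set D : ℕ → ℝ := fun n => dist x (f^[n] x) with hD
  refine ⟨fun n => √(2 * D n * (D n - n * l + 1)), ?_, ?_⟩
  · have h1 : Tendsto (fun n : ℕ => D n / n) atTop (𝓝 l) := tendsto_dist_iterate_div hf hy x
    have h2 : Tendsto (fun n : ℕ => √(2 * (D n / n) * (D n / n - l + 1 / n))) atTop (𝓝 0) := by
      simpa using ((h1.const_mul 2).mul
        ((h1.sub_const l).add tendsto_one_div_atTop_nhds_zero_nat)).sqrt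
    refine h2.congr' ?_
    filter_upwards [eventually_gt_atTop 0] with n hn
    have hn' : (0 : ℝ) < n := by exact_mod_cast hn
    rw [eq_div_iff hn'.ne', ← Real.sqrt_sq hn'.le, ← Real.sqrt_mul' _ (sq_nonneg _),
      Real.sqrt_sq hn'.le]
    congr 1
    field_simp
  · have hlarge : Tendsto (fun n : ℕ => (n : ℝ) * l) atTop atTop :=
      tendsto_natCast_atTop_atTop.atTop_mul_const hl0
    filter_upwards [hlarge.eventually_ge_atTop 1] with n hn
    filter_upwards [eventually_dist_iterate_le hy x n one_pos,
      (tendsto_dist_atTop hl hy x).eventually_ge_atTop (n * l)] with k hk hT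
    have hT0 : 0 < dist x (y k) := by linarith
    refine Real.le_sqrt_of_sq_le (((hc k).dist_sq_le_add (f^[n] x) ⟨by linarith, hT⟩
      hT0).trans ?_)
    set h := dist (f^[n] x) (y k) - dist x (y k) with hh
    have hDl : n * l ≤ D n := mul_minimalDisplacement_le_dist_iterate hy x n
    have h1 : -D n ≤ h := by linarith [dist_triangle x (f^[n] x) (y k)]
    have h2 : h ≤ -(n * l) + 1 := by linarith
    have h3 : (n * l + h) ^ 2 ≤ (D n - n * l + 1) ^ 2 := sq_le_sq' (by linarith) (by linarith)
    have h4 : (n * l - 1) ^ 2 ≤ h ^ 2 := by nlinarith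
    have h5 : 0 ≤ D n ^ 2 - h ^ 2 := by nlinarith
    have h6 : (1 - n * l / dist x (y k)) * (D n ^ 2 - h ^ 2) ≤ D n ^ 2 - h ^ 2 :=
      mul_le_of_le_one_left h5 (sub_le_self _ (by positivity))
    -- `(D - nl + 1)² + D² - (nl - 1)² = 2 D (D - nl + 1)`
    linarith

end Drift

/-! ### The limiting ray -/

section Ray

variable {X : Type*} [MetricSpace X]

theorem GeodesicRay.dist_toNNReal (γ : GeodesicRay X) {s t : ℝ} (hs : 0 ≤ s) (ht : 0 ≤ t) :
    dist (γ s.toNNReal) (γ t.toNNReal) = |s - t| := by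
  rw [γ.isometry.dist_eq, NNReal.dist_eq, Real.coe_toNNReal s hs, Real.coe_toNNReal t ht]

theorem GeodesicRay.mul_dist_le_mul_dist [CAT0Space X] {γ γ' : GeodesicRay X} (h0 : γ 0 = γ' 0)
    {r m : ℝ≥0} (hr : r ≤ m) : m * dist (γ r) (γ' r) ≤ r * dist (γ m) (γ' m) := by
  have h := _root_.mul_dist_le_mul_dist (c₁ := fun s : ℝ => γ s.toNNReal)
    (c₂ := fun s : ℝ => γ' s.toNNReal) (r := r) (m := m)
    (fun s hs t ht => γ.dist_toNNReal hs.1 ht.1) (fun s hs t ht => γ'.dist_toNNReal hs.1 ht.1)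
    (by simpa using h0) ⟨r.2, by exact_mod_cast hr⟩
  simpa only [Real.toNNReal_coe] using h

/-- Two rays with the same origin at sublinear distance are equal. -/
theorem GeodesicRay.eq_of_tendsto_dist [CAT0Space X] {γ γ' : GeodesicRay X} (h0 : γ 0 = γ' 0)
    {l : ℝ≥0} (hl : 0 < l)
    (h : Tendsto (fun n : ℕ => 1 / (n : ℝ) * dist (γ (l * n)) (γ' (l * n))) atTop (𝓝 0)) :
    γ = γ' := by
  ext r
  refine dist_le_zero.1 (ge_of_tendsto (b := dist (γ r) (γ' r))
    (by simpa only [mul_zero] using h.const_mul (r / l : ℝ)) ?_)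
  have hlarge : Tendsto (fun n : ℕ => l * (n : ℝ≥0)) atTop atTop :=
    tendsto_natCast_atTop_atTop.const_mul_atTop hl
  filter_upwards [hlarge.eventually_ge_atTop r, eventually_gt_atTop 0] with n hn hn0
  have h1 := GeodesicRay.mul_dist_le_mul_dist h0 hn
  have hn' : (0 : ℝ) < n := by exact_mod_cast hn0
  have hl' : (0 : ℝ) < l := hl
  push_cast at h1
  rw [← mul_assoc, div_mul_div_comm, mul_one, div_mul_eq_mul_div, le_div_iff₀ (by positivity)]
  linarith

/-- Geodesics `[x, y k]` of lengths tending to infinity which track a common sequence of points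
up to a sublinear error converge to a ray. -/
theorem exists_ray_tendsto [CAT0Space X] [CompleteSpace X] {x : X} {y p : ℕ → X}
    {c : ℕ → ℝ → X} (hc : ∀ k, IsGeodesic (c k) x (y k))
    (hy : Tendsto (fun k => dist x (y k)) atTop atTop) {l : ℝ} (hl : 0 < l) {E : ℕ → ℝ}
    (hE : Tendsto (fun n => E n / n) atTop (𝓝 0))
    (hp : ∀ᶠ n : ℕ in atTop, ∀ᶠ k in atTop, dist (c k (n * l)) (p n) ≤ E n) :
    ∃ γ : GeodesicRay X, γ 0 = x ∧ ∀ t : ℝ≥0, Tendsto (fun k => c k t) atTop (𝓝 (γ t)) := by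
  have hcauchy : ∀ R : ℝ≥0, CauchySeq fun k => c k R := fun R => by
    refine Metric.cauchySeq_iff.2 fun ε hε => ?_
    have hlarge : Tendsto (fun n : ℕ => (n : ℝ) * l) atTop atTop :=
      tendsto_natCast_atTop_atTop.atTop_mul_const hl
    have hsmall : Tendsto (fun n => (2 * R : ℝ) * (E n / n)) atTop (𝓝 0) := by
      simpa using hE.const_mul (2 * R : ℝ)
    obtain ⟨n, hn, hR, hEn, hn0⟩ := (hp.and ((hlarge.eventually_ge_atTop (R : ℝ)).and
      ((hsmall.eventually_lt_const (mul_pos hε hl)).and (eventually_gt_atTop 0)))).exists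
    have hn' : (0 : ℝ) < n := by exact_mod_cast hn0
    rw [← mul_div_assoc, div_lt_iff₀ hn'] at hEn
    obtain ⟨N, hN⟩ := eventually_atTop.1 (hn.and (hy.eventually_ge_atTop (n * l)))
    refine ⟨N, fun i hi j hj => ?_⟩
    have hgeo : ∀ k, N ≤ k → ∀ s ∈ Icc 0 (n * l), ∀ t ∈ Icc 0 (n * l),
        dist (c k s) (c k t) = |s - t| := fun k hk s hs t ht =>
      (hc k).isometric s ⟨hs.1, hs.2.trans (hN k hk).2⟩ t ⟨ht.1, ht.2.trans (hN k hk).2⟩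
    have h1 := mul_dist_le_mul_dist (hgeo i hi) (hgeo j hj)
      ((hc i).left.trans (hc j).left.symm) ⟨R.coe_nonneg, hR⟩
    have h2 : (R : ℝ) * dist (c i (n * l)) (c j (n * l)) ≤ R * (2 * E n) :=
      mul_le_mul_of_nonneg_left (by
        linarith [dist_triangle_right (c i (n * l)) (c j (n * l)) (p n), (hN i hi).1,
          (hN j hj).1]) R.coe_nonneg
    refine lt_of_mul_lt_mul_left ?_ (mul_pos hn' hl).le
    linarith
  choose γ hγ using fun R => cauchySeq_tendsto_of_complete (hcauchy R)
  refine ⟨⟨γ, Isometry.of_dist_eq fun s t => ?_⟩, ?_, hγ⟩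
  · refine tendsto_nhds_unique ((hγ s).dist (hγ t)) (tendsto_const_nhds.congr' ?_)
    filter_upwards [hy.eventually_ge_atTop (s : ℝ), hy.eventually_ge_atTop (t : ℝ)] with k hs ht
    rw [(hc k).isometric s ⟨s.2, hs⟩ t ⟨t.2, ht⟩, NNReal.dist_eq]
  · refine tendsto_nhds_unique (hγ 0) ?_
    simp only [NNReal.coe_zero, (hc _).left]
    exact tendsto_const_nhds

/-- A geodesic `[x, z]` passes, at time `R`, at distance at most `R + dist p z - dist x z` from `p`,
up to an error tending to zero as `R → ∞`, uniformly in `z`. -/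
theorem IsGeodesic.dist_sub_le_add [CAT0Space X] {x z : X} {c : ℝ → X} (hc : IsGeodesic c x z)
    (p : X) {R : ℝ} (hR : dist x p < R) (hRz : R ≤ dist x z) :
    dist p (c R) - R ≤ dist p z - dist x z + dist x p ^ 2 / (R - dist x p) := by
  have hD : 0 ≤ dist x p := dist_nonneg
  have h := hc.dist_sq_le_add p ⟨by linarith, hRz⟩ (by linarith)
  set D := dist x p
  set η := dist p z - dist x z
  have hη : -D ≤ η := by linarith [dist_triangle x p z]
  have hη' : η ≤ D := by linarith [dist_triangle_left p z x]
  have hRD : 0 < R - D := by linarith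
  have h0 : 0 ≤ D ^ 2 - η ^ 2 := by linarith [sq_le_sq' hη hη']
  have h1 : (1 - R / dist x z) * (D ^ 2 - η ^ 2) ≤ D ^ 2 - η ^ 2 :=
    mul_le_of_le_one_left h0
      (sub_le_self _ (div_nonneg (by linarith) dist_nonneg))
  set q := D ^ 2 / (R - D) with hq
  have hq0 : 0 ≤ q := by positivity
  have h2 : q * (R - D) = D ^ 2 := div_mul_cancel₀ _ hRD.ne'
  have h3 : q * (R - D) ≤ q * (R + η) := mul_le_mul_of_nonneg_left (by linarith) hq0
  have h4 : dist (c R) p ≤ R + η + q := by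
    refine le_of_sq_le_sq (h.trans ?_) (by linarith)
    nlinarith [sq_nonneg q, sq_nonneg η, sq_nonneg D]
  rw [dist_comm p]
  linarith

/-- If the geodesics `[x, y k]` converge to the ray `γ`, then `dist · (y k) - dist x (y k)`
converges to the Busemann function of `γ`; decay of the former under `f` passes to the latter. -/
theorem GeodesicRay.busemann_le_of_tendsto [CAT0Space X] {x : X} {y : ℕ → X} {c : ℕ → ℝ → X}
    (hc : ∀ k, IsGeodesic (c k) x (y k)) (hy : Tendsto (fun k => dist x (y k)) atTop atTop)
    {γ : GeodesicRay X} (hγ : ∀ t : ℝ≥0, Tendsto (fun k => c k t) atTop (𝓝 (γ t)))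
    {u v : X} {l : ℝ} (h : ∀ ε > 0, ∀ᶠ k in atTop, dist v (y k) ≤ dist u (y k) - l + ε) :
    γ.busemann v ≤ γ.busemann u - l := by
  refine le_of_forall_pos_le_add fun ε hε => ?_
  have hcoe : Tendsto (fun R : ℝ≥0 => (R : ℝ)) atTop atTop := NNReal.tendsto_coe_atTop.2 tendsto_id
  have herr : Tendsto (fun R : ℝ≥0 => dist x v ^ 2 / (R - dist x v)) atTop (𝓝 0) :=
    (tendsto_atTop_add_const_right _ (-dist x v) hcoe).const_div_atTop _
  have hlim : Tendsto (fun R : ℝ≥0 => dist u (γ R) - R - l + ε + dist x v ^ 2 / (R - dist x v))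
      atTop (𝓝 (γ.busemann u - l + ε)) := by
    simpa using (((γ.tendsto_busemann u).sub_const l).add_const ε).add herr
  refine le_of_tendsto_of_tendsto (γ.tendsto_busemann v) hlim ?_
  filter_upwards [hcoe.eventually_gt_atTop (dist x v)] with R hR
  refine le_of_tendsto_of_tendsto ((tendsto_const_nhds.dist (hγ R)).sub_const _)
    (((((tendsto_const_nhds.dist (hγ R)).sub_const _).sub_const _).add_const _).add_const _) ?_
  filter_upwards [h ε hε, hy.eventually_ge_atTop (R : ℝ)] with k hk hRk
  have h1 := (hc k).dist_sub_le_add v hR hRk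
  have h2 := (hc k).dist_right ⟨R.coe_nonneg, hRk⟩
  linarith [dist_triangle u (c k R) (y k)]

/-- Existence of the ray, with the decay of its Busemann function. -/
theorem exists_ray_tendsto_dist_iterate [CAT0Space X] [CompleteSpace X] {f : X → X}
    (hf : ∀ x y : X, dist (f x) (f y) ≤ dist x y) (hl : 0 < minimalDisplacement f) (x : X) :
    ∃ γ : GeodesicRay X, γ 0 = x ∧
      Tendsto (fun n : ℕ => 1 / (n : ℝ) * dist (f^[n] x) (γ (minimalDisplacement f * n)))
        atTop (𝓝 0) ∧
      ∀ y : X, γ.busemann (f y) ≤ γ.busemann y - minimalDisplacement f := by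
  have : Nonempty X := ⟨x⟩
  obtain ⟨y, hy⟩ := exists_seq_eventually_dist_le hf
  choose c hc using fun k => CAT0Space.exists_geodesic x (y k)
  obtain ⟨E, hE, hp⟩ := exists_sublinear_dist_iterate_le hf hl hy hc
  have hT := tendsto_dist_atTop hl hy x
  obtain ⟨γ, h0, hγ⟩ := exists_ray_tendsto hc hT (NNReal.coe_pos.2 hl) hE hp
  refine ⟨γ, h0, ?_, fun u => GeodesicRay.busemann_le_of_tendsto hc hT hγ (hy u)⟩
  refine squeeze_zero' (Eventually.of_forall fun n => by positivity) ?_ hE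
  filter_upwards [hp] with n hn
  have hlim := hγ (n * minimalDisplacement f)
  push_cast at hlim
  have h := le_of_tendsto (hlim.dist tendsto_const_nhds) hn
  rw [mul_comm (minimalDisplacement f), dist_comm, one_div_mul_eq_div]
  gcongr

end Ray

/-! ### Convergence in the cone topology -/

section Cone

variable {X : Type*} [MetricSpace X] [CAT0Space X]

/-- The geodesics from the origin of a ray to points at sublinear distance from the ray converge to
the ray. -/
theorem GeodesicRay.eventually_dist_geodesic_lt (γ : GeodesicRay X) {p : ℕ → X} {l : ℝ≥0}
    (hl : 0 < l)
    (h : Tendsto (fun n : ℕ => 1 / (n : ℝ) * dist (p n) (γ (l * n))) atTop (𝓝 0))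
    (r : ℝ≥0) {ε : ℝ} (hε : 0 < ε) :
    ∀ᶠ n in atTop, (r : ℝ) < dist (γ 0) (p n) ∧
      ∀ σ : ℝ → X, IsGeodesic σ (γ 0) (p n) → dist (σ r) (γ r) < ε := by
  have hl' : (0 : ℝ) < l := hl
  have hlarge : Tendsto (fun n : ℕ => (l / 2 : ℝ) * n) atTop atTop :=
    tendsto_natCast_atTop_atTop.const_mul_atTop (half_pos hl')
  have hsmall : Tendsto (fun n : ℕ => (2 * r + ε : ℝ) * (1 / (n : ℝ) * dist (p n) (γ (l * n))))
      atTop (𝓝 0) := by simpa using h.const_mul (2 * r + ε : ℝ)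
  filter_upwards [hlarge.eventually_gt_atTop (r : ℝ), eventually_gt_atTop 0,
    h.eventually_lt_const (half_pos hl'), hsmall.eventually_lt_const (mul_pos hε hl')]
    with n h1 hn h2 h3
  have hn' : (0 : ℝ) < n := by exact_mod_cast hn
  set δ := dist (p n) (γ (l * n)) with hδ
  rw [one_div_mul_eq_div, div_lt_iff₀ hn'] at h2
  rw [one_div_mul_eq_div, ← mul_div_assoc, div_lt_iff₀ hn'] at h3
  have hr0 : (0 : ℝ) ≤ r := r.2
  have hln : (0 : ℝ) ≤ l * n := by positivity
  have e1 : dist (γ 0) (γ (l * n)) = l * n := by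
    rw [γ.isometry.dist_eq, NNReal.dist_eq]
    simp
  have h4 : dist (γ 0) (p n) ≤ l * n + δ := by
    linarith [dist_triangle_right (γ 0) (p n) (γ (l * n))]
  have h5 : l * n ≤ dist (γ 0) (p n) + δ := by
    linarith [dist_triangle (γ 0) (p n) (γ (l * n))]
  refine ⟨by linarith, fun σ hσ => ?_⟩
  set m := min (dist (γ 0) (p n)) (l * n) with hm
  have hm1 : m ≤ dist (γ 0) (p n) := min_le_left _ _
  have hm2 : m ≤ l * n := min_le_right _ _
  have hm3 : l * n - δ ≤ m := le_min (by linarith) (sub_le_self _ dist_nonneg)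
  have hrm : (r : ℝ) ≤ m := by linarith
  have hm0 : 0 < m := by linarith
  have h6 := _root_.mul_dist_le_mul_dist (c₁ := σ) (c₂ := fun s : ℝ => γ s.toNNReal) (r := r) (m := m)
    (fun s hs t ht => hσ.isometric s ⟨hs.1, hs.2.trans hm1⟩ t ⟨ht.1, ht.2.trans hm1⟩)
    (fun s hs t ht => γ.dist_toNNReal hs.1 ht.1) (by simpa using hσ.left) ⟨hr0, hrm⟩
  simp only [Real.toNNReal_coe] at h6
  have h7 : dist (σ m) (p n) = dist (γ 0) (p n) - m := hσ.dist_right ⟨hm0.le, hm1⟩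
  have h8 : dist (γ (l * n)) (γ m.toNNReal) = l * n - m := by
    rw [γ.isometry.dist_eq, NNReal.dist_eq, Real.coe_toNNReal m hm0.le, abs_of_nonneg] <;>
      push_cast <;> linarith
  have h9 : dist (σ m) (γ m.toNNReal) ≤ 2 * δ := by
    have := dist_triangle4 (σ m) (p n) (γ (l * n)) (γ m.toNNReal)
    rcases min_choice (dist (γ 0) (p n)) (l * n) with h | h <;> rw [← hm] at h <;> linarith
  have h10 : (r : ℝ) * dist (σ m) (γ m.toNNReal) ≤ r * (2 * δ) :=
    mul_le_mul_of_nonneg_left h9 hr0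
  have h11 : ε * (l * n - δ) ≤ ε * m := mul_le_mul_of_nonneg_left hm3 hε.le
  refine lt_of_mul_lt_mul_left ?_ hm0.le
  linarith

/-- A cone neighbourhood of the class of `γ` may be based at a point other than `γ 0`. The ray
in that class issuing from its base point is the one that tracks the orbit of the base point. -/
theorem tendsto_inner_iterate [CompleteSpace X] {f : X → X}
    (hf : ∀ x y : X, dist (f x) (f y) ≤ dist x y) (hl : 0 < minimalDisplacement f)
    {γ : GeodesicRay X} {x : X}
    (hγ : Tendsto (fun n : ℕ => 1 / (n : ℝ) * dist (f^[n] x) (γ (minimalDisplacement f * n)))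
      atTop (𝓝 0)) (y : X) :
    Tendsto (fun n : ℕ => VisualBordification.inner (f^[n] y)) atTop
      (𝓝 (VisualBordification.ideal γ.endpoint)) := by
  -- Sublinear tracking does not depend on the orbit.
  have hbase : ∀ (γ : GeodesicRay X) (u v : X),
      Tendsto (fun n : ℕ => 1 / (n : ℝ) * dist (f^[n] u) (γ (minimalDisplacement f * n)))
        atTop (𝓝 0) →
      Tendsto (fun n : ℕ => 1 / (n : ℝ) * dist (f^[n] v) (γ (minimalDisplacement f * n)))
        atTop (𝓝 0) := fun γ u v h => by
    refine squeeze_zero (fun n => by positivity) (fun n => ?_)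
      (by simpa only [zero_mul, add_zero] using
        (tendsto_one_div_atTop_nhds_zero_nat.mul_const (dist v u)).add h)
    rw [← mul_add]
    gcongr
    exact (dist_triangle _ (f^[n] u) _).trans (add_le_add_left (dist_iterate_le hf n v u) _)
  refine TopologicalSpace.tendsto_nhds_generateFrom_iff.2 ?_
  rintro _ (⟨z, r, rfl⟩ | ⟨c, r, ε, hr, hε, rfl⟩) hU
  · obtain ⟨w, -, hw⟩ := hU
    cases hw
  obtain ⟨γ₁, h0, hend, hlt⟩ := hU
  obtain ⟨K, hK⟩ : ∃ K : ℝ, ∀ t : ℝ≥0, dist (γ₁ t) (γ t) ≤ K := Quotient.exact hend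
  obtain ⟨γ₂, h0', hγ₂, -⟩ := exists_ray_tendsto_dist_iterate hf hl (c 0)
  obtain rfl : γ₁ = γ₂ := by
    refine GeodesicRay.eq_of_tendsto_dist (h0.trans h0'.symm) hl ?_
    refine squeeze_zero (fun n => by positivity) (fun n => ?_)
      (by simpa only [zero_mul, add_zero] using ((tendsto_one_div_atTop_nhds_zero_nat.mul_const K).add
        (hbase γ x (c 0) hγ)).add hγ₂)
    rw [← mul_add, ← mul_add]
    gcongr
    have h1 := dist_triangle4 (γ₁ (minimalDisplacement f * n)) (γ (minimalDisplacement f * n))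
      (f^[n] (c 0)) (γ₂ (minimalDisplacement f * n))
    rw [dist_comm (γ (minimalDisplacement f * n))] at h1
    linarith [hK (minimalDisplacement f * n)]
  filter_upwards [γ₁.eventually_dist_geodesic_lt hl (hbase γ₁ (c 0) y hγ₂) r
    (sub_pos.2 hlt)] with n hn
  obtain ⟨σ, hσ⟩ := CAT0Space.exists_geodesic (c 0) (f^[n] y)
  rw [h0] at hn
  refine ⟨hn.1, σ, hσ, ?_⟩
  linarith [hn.2 σ hσ, dist_triangle (σ r) (γ₁ r) (c r)]

end Cone

/-! ### Orbits of nonexpansive maps -/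

theorem mainTheorem4 {X : Type*} [MetricSpace X] [CompleteSpace X] [CAT0Space X] [Nonempty X]
    (f : X → X) (hf : ∀ x y : X, dist (f x) (f y) ≤ dist x y) :
    ((∀ x : X, Bornology.IsBounded (range (fun n : ℕ => f^[n] x))) → ∃ x : X, f x = x) ∧
    (0 < minimalDisplacement f → ∀ x : X, ∃ γ : GeodesicRay X,
      (γ 0 = x ∧ Tendsto
        (fun n : ℕ => 1 / (n : ℝ) * dist (f^[n] x) (γ (minimalDisplacement f * n)))
        atTop (𝓝 0)) ∧
      (∀ γ' : GeodesicRay X, γ' 0 = x → Tendsto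
        (fun n : ℕ => 1 / (n : ℝ) * dist (f^[n] x) (γ' (minimalDisplacement f * n)))
        atTop (𝓝 0) → γ' = γ) ∧
      (∀ y : X, γ.busemann (f y) ≤ γ.busemann y - minimalDisplacement f) ∧
      (∀ y : X, Tendsto (fun n : ℕ => VisualBordification.inner (f^[n] y)) atTop
        (𝓝 (VisualBordification.ideal γ.endpoint)))) ∧
    (minimalDisplacement f = 0 → ∀ x₀ : X, ∃ h : X → ℝ, IsMetricFunctional x₀ h ∧
      ∀ x : X, h (f x) ≤ h x) := by
  refine ⟨fun hb => ?_, fun hl x => ?_, fun h0 x₀ => ?_⟩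
  · obtain ⟨x⟩ := ‹Nonempty X›
    exact exists_fixedPoint_of_isBounded_orbit hf (hb x)
  · obtain ⟨γ, hγ0, hγ, hb⟩ := exists_ray_tendsto_dist_iterate hf hl x
    refine ⟨γ, ⟨hγ0, hγ⟩, fun γ' hγ'0 hγ' => ?_, hb, tendsto_inner_iterate hf hl hγ⟩
    refine GeodesicRay.eq_of_tendsto_dist (hγ'0.trans hγ0.symm) hl ?_
    refine squeeze_zero (fun n => by positivity) (fun n => ?_) (by simpa only [add_zero] using hγ'.add hγ)
    rw [← mul_add]
    gcongr
    exact dist_triangle_left _ _ _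
  · obtain ⟨h, hh, hle⟩ := exists_isMetricFunctional_le hf x₀
    exact ⟨h, hh, fun x => by simpa [h0] using hle x⟩
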